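/- Fix a first-order signature $\Sigma$ and a countably infinite set $\mathrm{Var}$ of variables. All first-order models $M$ are assumed to have at least two elements. A team over $M$ is a set of assignments $s:\mathrm{Var}\to \mathrm{dom}(M)$. For a team $X$, a variable $v$ and a function $F:X\to\mathrm{dom}(M)$ let $X[F/v]=\{s[F(s)/v] : s\in X\}$ and $X[M/v]=\{s[m/v] : s\in X,\ m\in\mathrm{dom}(M)\}$. A literal is $R\vec t$, $\lnot R\vec t$, $t_1=t_2$ or $t_1\neq t_2$, where $R$ is a relation symbol of $\Sigma$ and the $t_i$ are $\Sigma$-terms; a dependence atom is $=\!(t_1,\dots,t_n)$ with $n\ge 1$. In both logics below, $M\models_X\alpha$ holds for a literal $\alpha$ iff every $s\in X$ satisfies $\alpha$ in $M$, and $M\models_X{=\!(t_1,\dots,t_n)}$ holds iff any two $s,s'\in X$ that agree on the values of $t_1,\dots,t_{n-1}$ agree on the value of $t_n$. Dependence Logic (DL) formulas are built from literals and dependence atoms by $\vee,\wedge,\exists v,\forall v$, with: $M\models_X\psi_1\vee\psi_2$ iff $X=Y_1\cup Y_2$ for some teams with $M\models_{Y_1}\psi_1$ and $M\models_{Y_2}\psi_2$;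 $M\models_X\psi_1\wedge\psi_2$ iff $M\models_X\psi_1$ and $M\models_X\psi_2$; $M\models_X\exists v\,\psi$ iff $M\models_{X[F/v]}\psi$ for some $F:X\to\mathrm{dom}(M)$; $M\models_X\forall v\,\psi$ iff $M\models_{X[M/v]}\psi$. Transition Dependence Logic (TDL) has transition terms $\tau$ and formulas $\phi$, defined by simultaneous recursion: $\tau ::= \exists v \mid \forall v \mid \phi? \mid \tau\otimes\tau \mid \tau\cap\tau \mid \tau;\tau$, and $\phi ::= \text{literal} \mid {=\!(t_1,\dots,t_n)} \mid \phi\vee\phi \mid \phi\wedge\phi \mid \langle\tau\rangle\phi$. The relation $M\models_{X\to Y}\tau$ (the transition $X\to Y$ is allowed by $\tau$) is given by: - $\exists v$: $X[F/v]\subseteq Y$ for some $F:X\to\mathrm{dom}(M)$; - $\forall v$: $X[M/v]\subseteq Y$; - $\phi?$: $M\models_X\phi$ and $X\subseteq Y$; - $\tau_1\otimes\tau_2$: $X=X_1\cup X_2$ for some teams with $M\models_{X_1\to Y}\tau_1$ and $M\models_{X_2\to Y}\tau_2$; - $\tau_1\cap\tau_2$: $M\models_{X\to Y}\tau_1$ and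 $M\models_{X\to Y}\tau_2$; - $\tau_1;\tau_2$: for some team $Z$, $M\models_{X\to Z}\tau_1$ and $M\models_{Z\to Y}\tau_2$. For TDL formulas, $M\models_X\phi_1\vee\phi_2$ iff $M\models_X\phi_1$ or $M\models_X\phi_2$; $M\models_X\phi_1\wedge\phi_2$ iff $M\models_X\phi_1$ and $M\models_X\phi_2$; and $M\models_X\langle\tau\rangle\psi$ iff there is a team $Y$ with $M\models_{X\to Y}\tau$ and $M\models_Y\psi$. Theorem. For every TDL formula $\phi$ over $\Sigma$ there exists a DL formula $T(\phi)$ over $\Sigma$ such that $$M\models_X\phi \iff M\models_X T(\phi)$$ for all first-order models $M$ of signature $\Sigma$ with at least two elements and all teams $X$ over $M$. Furthermore, for every TDL transition term $\tau$ and every DL formula $\theta$ over $\Sigma$ there exists a DL formula $U(\tau,\theta)$ over $\Sigma$ such that $$M\models_X U(\tau,\theta) \iff \text{there is a team } Y \text{ with } M\models_{X\to Y}\tau \text{ and } M\models_Y\theta,$$ again for all first-order models $M$ of signature $\Sigma$ with at least two elements and all teams $X$ over $M$. -/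

import Mathlib

universe u v w

namespace TransitionDependence

/-- Literals and dependence atoms over a first-order signature `L`, with variables `ℕ`.
`dep ts t` is the dependence atom `=(t₁, …, tₙ)` with `t₁, …, tₙ₋₁` given by `ts` and `tₙ = t`
(so `k = 0` is the constancy atom `=(t)`). Equality is a logical symbol. -/
inductive Atom (L : FirstOrder.Language.{u, v}) : Type (max u v)
  | eq (t₁ t₂ : L.Term ℕ) : Atom L
  | neq (t₁ t₂ : L.Term ℕ) : Atom L
  | rel {n : ℕ} (R : L.Relations n) (ts : Fin n → L.Term ℕ) : Atom L
  | nrel {n : ℕ} (R : L.Relations n) (ts : Fin n → L.Term ℕ) : Atom L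
  | dep {k : ℕ} (ts : Fin k → L.Term ℕ) (t : L.Term ℕ) : Atom L

/-- Formulas of Dependence Logic, in negation normal form. -/
inductive DLFormula (L : FirstOrder.Language.{u, v}) : Type (max u v)
  | atom (α : Atom L) : DLFormula L
  | or (φ ψ : DLFormula L) : DLFormula L
  | and (φ ψ : DLFormula L) : DLFormula L
  | ex (x : ℕ) (φ : DLFormula L) : DLFormula L
  | all (x : ℕ) (φ : DLFormula L) : DLFormula L

mutual

/-- Transition terms of Transition Dependence Logic:
`∃x`, `∀x`, `φ?`, `τ₁ ⊗ τ₂`, `τ₁ ∩ τ₂`, `τ₁ ; τ₂`. -/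
inductive TDLTerm (L : FirstOrder.Language.{u, v}) : Type (max u v)
  | ex (x : ℕ) : TDLTerm L
  | all (x : ℕ) : TDLTerm L
  | test (φ : TDLFormula L) : TDLTerm L
  | tensor (τ₁ τ₂ : TDLTerm L) : TDLTerm L
  | inter (τ₁ τ₂ : TDLTerm L) : TDLTerm L
  | seq (τ₁ τ₂ : TDLTerm L) : TDLTerm L

/-- Formulas of Transition Dependence Logic:
literals, dependence atoms, `φ ∨ ψ`, `φ ∧ ψ`, `⟨τ⟩ φ`. -/
inductive TDLFormula (L : FirstOrder.Language.{u, v}) : Type (max u v)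
  | atom (α : Atom L) : TDLFormula L
  | or (φ ψ : TDLFormula L) : TDLFormula L
  | and (φ ψ : TDLFormula L) : TDLFormula L
  | diamond (τ : TDLTerm L) (φ : TDLFormula L) : TDLFormula L

end

/-- A team over `M`: a set of assignments, whose domain is the set `ℕ` of all variables. -/
abbrev Team (M : Type w) : Type w := Set (ℕ → M)

/-- `X[F/x] = {s[F(s)/x] : s ∈ X}`; only the values of `F` on `X` matter. -/
def Team.supplement {M : Type w} (X : Team M) (x : ℕ) (F : (ℕ → M) → M) : Team M :=
  {s' | ∃ s ∈ X, s' = Function.update s x (F s)}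

/-- `X[M/x] = {s[m/x] : s ∈ X, m ∈ M}`. -/
def Team.duplicate {M : Type w} (X : Team M) (x : ℕ) : Team M :=
  {s' | ∃ s ∈ X, ∃ m : M, s' = Function.update s x m}

/-- Satisfaction of a literal or a dependence atom by a team. -/
def Atom.Sat {L : FirstOrder.Language.{u, v}} {M : Type w} [L.Structure M] : Atom L → Team M → Prop
  | .eq t₁ t₂, X => ∀ s ∈ X, t₁.realize s = t₂.realize s
  | .neq t₁ t₂, X => ∀ s ∈ X, t₁.realize s ≠ t₂.realize s
  | .rel R ts, X => ∀ s ∈ X, FirstOrder.Language.Structure.RelMap R (fun i => (ts i).realize s)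
  | .nrel R ts, X => ∀ s ∈ X, ¬ FirstOrder.Language.Structure.RelMap R (fun i => (ts i).realize s)
  | .dep ts t, X => ∀ s ∈ X, ∀ s' ∈ X,
      (∀ i, (ts i).realize s = (ts i).realize s') → t.realize s = t.realize s'

/-- Team semantics of Dependence Logic. -/
def DLFormula.Sat {L : FirstOrder.Language.{u, v}} {M : Type w} [L.Structure M] :
    DLFormula L → Team M → Prop
  | .atom α, X => α.Sat X
  | .or φ ψ, X => ∃ Y Z : Team M, X = Y ∪ Z ∧ φ.Sat Y ∧ ψ.Sat Z
  | .and φ ψ, X => φ.Sat X ∧ ψ.Sat X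
  | .ex x φ, X => ∃ F : (ℕ → M) → M, φ.Sat (X.supplement x F)
  | .all x φ, X => φ.Sat (X.duplicate x)

mutual

/-- `τ.Allows X Y`: the transition `X → Y` is allowed by the transition term `τ` in `M`. -/
def TDLTerm.Allows {L : FirstOrder.Language.{u, v}} {M : Type w} [L.Structure M] :
    TDLTerm L → Team M → Team M → Prop
  | .ex x, X, Y => ∃ F : (ℕ → M) → M, X.supplement x F ⊆ Y
  | .all x, X, Y => X.duplicate x ⊆ Y
  | .test φ, X, Y => φ.Sat X ∧ X ⊆ Y
  | .tensor τ₁ τ₂, X, Y =>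
      ∃ X₁ X₂ : Team M, X = X₁ ∪ X₂ ∧ τ₁.Allows X₁ Y ∧ τ₂.Allows X₂ Y
  | .inter τ₁ τ₂, X, Y => τ₁.Allows X Y ∧ τ₂.Allows X Y
  | .seq τ₁ τ₂, X, Y => ∃ Z : Team M, τ₁.Allows X Z ∧ τ₂.Allows Z Y

/-- Satisfaction of a formula of Transition Dependence Logic by a team. -/
def TDLFormula.Sat {L : FirstOrder.Language.{u, v}} {M : Type w} [L.Structure M] :
    TDLFormula L → Team M → Prop
  | .atom α, X => α.Sat X
  | .or φ ψ, X => φ.Sat X ∨ ψ.Sat X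
  | .and φ ψ, X => φ.Sat X ∧ ψ.Sat X
  | .diamond τ φ, X => ∃ Y : Team M, τ.Allows X Y ∧ φ.Sat Y

end

end TransitionDependence

namespace TransitionDependence

open FirstOrder Language

variable {L : FirstOrder.Language.{u, v}} {M : Type w}

-- Formulas are translated by simultaneous recursion with the weakest preconditions of transition
-- terms. The obstacle is `⊗` and `∩`: both subterms must reach one common team `Y`, whereas
-- Dependence Logic handles only one current team. The remedy is to carry both branches in that one
-- team, tagged by two fresh variables `p`, `p + 1`: rows where they are equal belong to the first
-- branch, the others to the second. An existential choice of tags splits the team (`⊗`);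
-- universally quantified tags copy it into both branches (`∩`). The branches are then executed one
-- after the other, each leaving the other's rows untouched, and the postcondition is evaluated on
-- the union.
--
-- Hence the induction needs a relativized statement, `Translatable.definable`: execute the term on
-- the rows satisfying a guard and keep the remaining rows. Guards nest, and they mention only
-- variables that the term does not change, so rows can be kept inside the guard during execution
-- (`Translatable.restrict`). The tags are invisible to the postcondition because Dependence Logic
-- is local and downward closed; `DLFormula.exists_bound` captures both through `Team.Covered`, and
-- `Translatable.saturate` is the analogue for transitions. Two distinct elements of the model
-- supply the tags, and also the bit that defines classical disjunction.

-- Covering of teams up to a set of variables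

/-- Every assignment of `X'` agrees on `S` with some assignment of `X`. -/
def Team.Covered (S : Set ℕ) (X' X : Team M) : Prop :=
  ∀ s' ∈ X', ∃ s ∈ X, Set.EqOn s s' S

/-- All assignments agreeing on `S` with some assignment of `Y`. -/
def Team.saturate (S : Set ℕ) (Y : Team M) : Team M :=
  {s' | ∃ s ∈ Y, Set.EqOn s s' S}

lemma Team.covered_saturate (S : Set ℕ) (Y : Team M) : (Y.saturate S).Covered S Y :=
  fun _ h => h

lemma Team.covered_of_subset {S : Set ℕ} {X' X : Team M} (h : X' ⊆ X) : X'.Covered S X :=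
  fun s hs => ⟨s, h hs, fun _ _ => rfl⟩

lemma eqOn_update {S : Set ℕ} {s s' : ℕ → M} (h : Set.EqOn s s' S) (x : ℕ) (m : M) :
    Set.EqOn (Function.update s x m) (Function.update s' x m) S := by
  intro i hi
  by_cases hx : i = x
  · subst hx; simp
  · simp [hx, h hi]

lemma Team.Covered.supplement {S : Set ℕ} {X' X : Team M} (h : X'.Covered S X) (x : ℕ)
    (F : (ℕ → M) → M) :
    ∃ F' : (ℕ → M) → M, (X'.supplement x F').Covered S (X.supplement x F) := by
  have : ∀ s', ∃ s, s' ∈ X' → s ∈ X ∧ Set.EqOn s s' S := fun s' => by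
    by_cases hs : s' ∈ X'
    · obtain ⟨s, h1, h2⟩ := h s' hs
      exact ⟨s, fun _ => ⟨h1, h2⟩⟩
    · exact ⟨s', fun h => absurd h hs⟩
  choose g hg using this
  refine ⟨fun s' => F (g s'), ?_⟩
  rintro _ ⟨s', hs', rfl⟩
  exact ⟨_, ⟨g s', (hg s' hs').1, rfl⟩, eqOn_update (hg s' hs').2 _ _⟩

lemma Team.Covered.duplicate {S : Set ℕ} {X' X : Team M} (h : X'.Covered S X) (x : ℕ) :
    (X'.duplicate x).Covered S (X.duplicate x) := by
  rintro _ ⟨s', hs', m, rfl⟩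
  obtain ⟨s, hs, hss⟩ := h s' hs'
  exact ⟨_, ⟨s, hs, m, rfl⟩, eqOn_update hss _ _⟩

lemma Team.Covered.exists_union {S : Set ℕ} {X' Y Z : Team M} (h : X'.Covered S (Y ∪ Z)) :
    ∃ Y' Z' : Team M, X' = Y' ∪ Z' ∧ Y'.Covered S Y ∧ Z'.Covered S Z := by
  refine ⟨{s' ∈ X' | ∃ s ∈ Y, Set.EqOn s s' S}, {s' ∈ X' | ∃ s ∈ Z, Set.EqOn s s' S}, ?_,
    fun s hs => hs.2, fun s hs => hs.2⟩
  ext s'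
  constructor
  · intro hs
    obtain ⟨s, h1 | h1, h2⟩ := h s' hs
    · exact Or.inl ⟨hs, s, h1, h2⟩
    · exact Or.inr ⟨hs, s, h1, h2⟩
  · rintro (h | h) <;> exact h.1

lemma Team.Covered.union {S : Set ℕ} {X' X Y' Y : Team M} (hX : X'.Covered S X)
    (hY : Y'.Covered S Y) : (X' ∪ Y').Covered S (X ∪ Y) := by
  rintro s (hs | hs)
  · obtain ⟨t, ht, h⟩ := hX s hs
    exact ⟨t, Or.inl ht, h⟩
  · obtain ⟨t, ht, h⟩ := hY s hs
    exact ⟨t, Or.inr ht, h⟩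

/-! ### Locality of terms, atoms and formulas of Dependence Logic -/

lemma exists_bound_realize (t : L.Term ℕ) :
    ∃ N : ℕ, ∀ (M : Type w) [L.Structure M] (s s' : ℕ → M),
      Set.EqOn s s' (Set.Iio N) → t.realize s = t.realize s' := by
  induction t with
  | var i => exact ⟨i + 1, fun M _ s s' h => h (Nat.lt_succ_self i)⟩
  | func f ts ih =>
    choose N hN using ih
    refine ⟨Finset.univ.sup N, fun M _ s s' h => ?_⟩
    simp only [Term.realize_func]
    congr 1
    ext i
    exact hN i M s s' (h.mono (Set.Iio_subset_Iio (Finset.le_sup (Finset.mem_univ i))))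

lemma exists_bound_realize_fin {n : ℕ} (ts : Fin n → L.Term ℕ) :
    ∃ N : ℕ, ∀ (M : Type w) [L.Structure M] (s s' : ℕ → M),
      Set.EqOn s s' (Set.Iio N) → ∀ i, (ts i).realize s = (ts i).realize s' := by
  choose N hN using fun i => exists_bound_realize.{u, v, w} (ts i)
  exact ⟨Finset.univ.sup N, fun M _ s s' h i =>
    hN i M s s' (h.mono (Set.Iio_subset_Iio (Finset.le_sup (Finset.mem_univ i))))⟩

lemma Atom.exists_bound (α : Atom L) :
    ∃ N : ℕ, ∀ (M : Type w) [L.Structure M] (S : Set ℕ) (X X' : Team M),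
      Set.Iio N ⊆ S → X'.Covered S X → α.Sat X → α.Sat X' := by
  cases α with
  | eq t₁ t₂ =>
    obtain ⟨N₁, h₁⟩ := exists_bound_realize.{u, v, w} t₁
    obtain ⟨N₂, h₂⟩ := exists_bound_realize.{u, v, w} t₂
    refine ⟨max N₁ N₂, fun M _ S X X' hS hX h s' hs' => ?_⟩
    obtain ⟨s, hs, e⟩ := hX s' hs'
    rw [← h₁ M s s' (e.mono ((Set.Iio_subset_Iio (le_max_left _ _)).trans hS)),
      ← h₂ M s s' (e.mono ((Set.Iio_subset_Iio (le_max_right _ _)).trans hS))]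
    exact h s hs
  | neq t₁ t₂ =>
    obtain ⟨N₁, h₁⟩ := exists_bound_realize.{u, v, w} t₁
    obtain ⟨N₂, h₂⟩ := exists_bound_realize.{u, v, w} t₂
    refine ⟨max N₁ N₂, fun M _ S X X' hS hX h s' hs' => ?_⟩
    obtain ⟨s, hs, e⟩ := hX s' hs'
    rw [← h₁ M s s' (e.mono ((Set.Iio_subset_Iio (le_max_left _ _)).trans hS)),
      ← h₂ M s s' (e.mono ((Set.Iio_subset_Iio (le_max_right _ _)).trans hS))]
    exact h s hs
  | rel R ts =>
    obtain ⟨N, hN⟩ := exists_bound_realize_fin.{u, v, w} ts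
    refine ⟨N, fun M _ S X X' hS hX h s' hs' => ?_⟩
    obtain ⟨s, hs, e⟩ := hX s' hs'
    rw [← funext (hN M s s' (e.mono hS))]
    exact h s hs
  | nrel R ts =>
    obtain ⟨N, hN⟩ := exists_bound_realize_fin.{u, v, w} ts
    refine ⟨N, fun M _ S X X' hS hX h s' hs' => ?_⟩
    obtain ⟨s, hs, e⟩ := hX s' hs'
    rw [← funext (hN M s s' (e.mono hS))]
    exact h s hs
  | dep ts t =>
    obtain ⟨N₁, h₁⟩ := exists_bound_realize_fin.{u, v, w} ts
    obtain ⟨N₂, h₂⟩ := exists_bound_realize.{u, v, w} t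
    refine ⟨max N₁ N₂, fun M _ S X X' hS hX h a ha b hb hab => ?_⟩
    obtain ⟨s, hs, e⟩ := hX a ha
    obtain ⟨s', hs', e'⟩ := hX b hb
    have l₁ := (Set.Iio_subset_Iio (le_max_left N₁ N₂)).trans hS
    have l₂ := (Set.Iio_subset_Iio (le_max_right N₁ N₂)).trans hS
    rw [← h₂ M s a (e.mono l₂), ← h₂ M s' b (e'.mono l₂)]
    refine h s hs s' hs' fun i => ?_
    rw [h₁ M s a (e.mono l₁), h₁ M s' b (e'.mono l₁)]
    exact hab i

/-- A formula of Dependence Logic is local and downward closed. -/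
lemma DLFormula.exists_bound (φ : DLFormula L) :
    ∃ N : ℕ, ∀ (M : Type w) [L.Structure M] (S : Set ℕ) (X X' : Team M),
      Set.Iio N ⊆ S → X'.Covered S X → φ.Sat X → φ.Sat X' := by
  induction φ with
  | atom α => exact α.exists_bound
  | or φ ψ ih₁ ih₂ =>
    obtain ⟨N₁, h₁⟩ := ih₁
    obtain ⟨N₂, h₂⟩ := ih₂
    refine ⟨max N₁ N₂, fun M _ S X X' hS hX h => ?_⟩
    obtain ⟨Y, Z, rfl, hY, hZ⟩ := h
    obtain ⟨Y', Z', rfl, cY, cZ⟩ := hX.exists_union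
    exact ⟨Y', Z', rfl, h₁ M S Y Y' ((Set.Iio_subset_Iio (le_max_left _ _)).trans hS) cY hY,
      h₂ M S Z Z' ((Set.Iio_subset_Iio (le_max_right _ _)).trans hS) cZ hZ⟩
  | and φ ψ ih₁ ih₂ =>
    obtain ⟨N₁, h₁⟩ := ih₁
    obtain ⟨N₂, h₂⟩ := ih₂
    exact ⟨max N₁ N₂, fun M _ S X X' hS hX h =>
      ⟨h₁ M S X X' ((Set.Iio_subset_Iio (le_max_left _ _)).trans hS) hX h.1,
        h₂ M S X X' ((Set.Iio_subset_Iio (le_max_right _ _)).trans hS) hX h.2⟩⟩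
  | ex x φ ih =>
    obtain ⟨N, hN⟩ := ih
    refine ⟨N, fun M _ S X X' hS hX h => ?_⟩
    obtain ⟨F, hF⟩ := h
    obtain ⟨F', hF'⟩ := hX.supplement x F
    exact ⟨F', hN M S _ _ hS hF' hF⟩
  | all x φ ih =>
    obtain ⟨N, hN⟩ := ih
    exact ⟨N, fun M _ S X X' hS hX h => hN M S _ _ hS (hX.duplicate x) h⟩

lemma DLFormula.Sat.mono [L.Structure M] {φ : DLFormula L} {X X' : Team M} (h : φ.Sat X)
    (hX : X' ⊆ X) : φ.Sat X' := by
  obtain ⟨N, hN⟩ := φ.exists_bound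
  exact hN M Set.univ X X' (Set.subset_univ _) (Team.covered_of_subset hX) h

lemma DLFormula.sat_empty [L.Structure M] (φ : DLFormula L) : φ.Sat (∅ : Team M) := by
  induction φ with
  | atom α => cases α <;> exact fun s hs => hs.elim
  | or φ ψ ih₁ ih₂ => exact ⟨∅, ∅, (Set.union_self _).symm, ih₁, ih₂⟩
  | and φ ψ ih₁ ih₂ => exact ⟨ih₁, ih₂⟩
  | ex x φ ih =>
    -- Any function works on the empty team; this one exists even when `M` has no given element.
    refine ⟨fun s => s x, ih.mono ?_⟩
    rintro _ ⟨s, hs, -⟩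
    exact hs
  | all x φ ih =>
    refine DLFormula.Sat.mono (φ := φ) ih ?_
    rintro _ ⟨s, hs, -⟩
    exact hs

/-! ### Some formulas of Dependence Logic -/

/-- The literal `x = y` for variables `x`, `y`. -/
def DLFormula.varEq (L : FirstOrder.Language.{u, v}) (x y : ℕ) : DLFormula L :=
  .atom (.eq (.var x) (.var y))

/-- The literal `x ≠ y` for variables `x`, `y`. -/
def DLFormula.varNe (L : FirstOrder.Language.{u, v}) (x y : ℕ) : DLFormula L :=
  .atom (.neq (.var x) (.var y))

lemma DLFormula.sat_varEq [L.Structure M] {x y : ℕ} {X : Team M} :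
    (varEq L x y).Sat X ↔ X ⊆ {s | s x = s y} := Iff.rfl

lemma DLFormula.sat_varNe [L.Structure M] {x y : ℕ} {X : Team M} :
    (varNe L x y).Sat X ↔ X ⊆ {s | s x = s y}ᶜ := Iff.rfl

/-- A flat disjunct can absorb all of `X ∩ D`, and by downward closure that is the best choice.
Disjunction with a flat formula thus acts as relativization to its complement. -/
lemma DLFormula.sat_or_left [L.Structure M] {δ φ : DLFormula L} {D : Team M}
    (hδ : ∀ X : Team M, δ.Sat X ↔ X ⊆ D) (X : Team M) :
    (DLFormula.or δ φ).Sat X ↔ φ.Sat (X \ D) := by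
  constructor
  · rintro ⟨Y, Z, rfl, hY, hZ⟩
    refine hZ.mono ?_
    rintro s ⟨hs | hs, hD⟩
    · exact absurd ((hδ Y).1 hY hs) hD
    · exact hs
  · intro h
    exact ⟨X ∩ D, X \ D, (Set.inter_union_sdiff X D).symm, (hδ _).2 Set.inter_subset_right, h⟩

/-- Saves the value of `x` in `y`, so that after `x` is requantified the old value is still
available for comparison. -/
lemma DLFormula.sat_copy [L.Structure M] {x y : ℕ} (hxy : x ≠ y) (φ : DLFormula L) (X : Team M) :
    (DLFormula.ex y (.and (varEq L y x) φ)).Sat X ↔ φ.Sat (X.supplement y fun s => s x) := by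
  constructor
  · rintro ⟨F, h₁, h₂⟩
    refine h₂.mono ?_
    rintro _ ⟨s, hs, rfl⟩
    have := sat_varEq.1 h₁ ⟨s, hs, rfl⟩
    simp only [Set.mem_ofPred_eq, Function.update_self, Function.update_of_ne hxy] at this
    exact ⟨s, hs, by rw [this]⟩
  · intro h
    refine ⟨_, ?_, h⟩
    rw [sat_varEq]
    rintro _ ⟨s, hs, rfl⟩
    simp [hxy]

/-- Classical disjunction is definable in Dependence Logic over structures with two elements. -/
lemma DLFormula.exists_classical_or (φ ψ : DLFormula L) :
    ∃ χ : DLFormula L, ∀ (M : Type w) [L.Structure M] [Nontrivial M] (X : Team M),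
      χ.Sat X ↔ φ.Sat X ∨ ψ.Sat X := by
  obtain ⟨N₁, h₁⟩ := φ.exists_bound
  obtain ⟨N₂, h₂⟩ := ψ.exists_bound
  set p := max N₁ N₂ with hp
  have l₁ : Set.Iio N₁ ⊆ Set.Iio p := Set.Iio_subset_Iio (le_max_left _ _)
  have l₂ : Set.Iio N₂ ⊆ Set.Iio p := Set.Iio_subset_Iio (le_max_right _ _)
  have const : ∀ x : ℕ, ∀ (M : Type w) [L.Structure M] (X : Team M),
      (DLFormula.atom (L := L) (.dep (k := 0) Fin.elim0 (.var x))).Sat X ↔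
        ∀ s ∈ X, ∀ s' ∈ X, s x = s' x := by
    intro x M _ X
    exact ⟨fun h s hs s' hs' => h s hs s' hs' fun i => i.elim0,
      fun h s hs s' hs' _ => h s hs s' hs'⟩
  -- Constancy makes "`p` equals `p + 1`" a single bit for the whole team. The two disjunctions say
  -- that `φ` holds on the rows where they are equal and `ψ` on the rows where they differ.
  refine ⟨.ex p (.ex (p + 1) (.and (.atom (.dep (k := 0) Fin.elim0 (.var p)))
    (.and (.atom (.dep (k := 0) Fin.elim0 (.var (p + 1))))
      (.and (.or (varNe L p (p + 1)) φ) (.or (varEq L p (p + 1)) ψ))))), ?_⟩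
  intro M _ _ X
  have agree : ∀ (s : ℕ → M) (a b : M),
      Set.EqOn s (Function.update (Function.update s p a) (p + 1) b) (Set.Iio p) := by
    intro s a b i hi
    have hi : i < p := hi
    rw [Function.update_of_ne (by omega), Function.update_of_ne (by omega)]
  constructor
  · rintro ⟨F, G, hF, hG, hφ, hψ⟩
    rw [const] at hF hG
    rw [sat_or_left fun _ => sat_varNe] at hφ
    rw [sat_or_left fun _ => sat_varEq] at hψ
    have cov : X.Covered (Set.Iio p) ((X.supplement p F).supplement (p + 1) G) := by
      intro s hs
      exact ⟨_, ⟨_, ⟨s, hs, rfl⟩, rfl⟩, (agree s _ _).symm⟩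
    by_cases h : ∀ s ∈ (X.supplement p F).supplement (p + 1) G, s p = s (p + 1)
    · left
      refine h₁ M _ _ _ l₁ cov (hφ.mono fun s hs => ⟨hs, ?_⟩)
      simpa using h s hs
    · right
      push Not at h
      obtain ⟨s, hs, hne⟩ := h
      refine h₂ M _ _ _ l₂ cov (hψ.mono fun s' hs' => ⟨hs', ?_⟩)
      show s' p ≠ s' (p + 1)
      rwa [hF s' hs' s hs, hG s' hs' s hs]
  · obtain ⟨a, b, hab⟩ := exists_pair_ne M
    have cov : ∀ c : M, ((X.supplement p fun _ => a).supplement (p + 1) fun _ => c).Covered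
        (Set.Iio p) X := by
      rintro c _ ⟨_, ⟨s, hs, rfl⟩, rfl⟩
      exact ⟨s, hs, agree s _ _⟩
    have key : ∀ c : M, (φ.Sat X ∨ a ≠ c) → (ψ.Sat X ∨ a = c) →
        ((DLFormula.ex p (.ex (p + 1) (.and (.atom (.dep (k := 0) Fin.elim0 (.var p)))
          (.and (.atom (.dep (k := 0) Fin.elim0 (.var (p + 1))))
          (.and (.or (varNe L p (p + 1)) φ) (.or (varEq L p (p + 1)) ψ)))))).Sat X) := by
      intro c hφ hψ
      refine ⟨fun _ => a, fun _ => c, ?_, ?_, ?_, ?_⟩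
      · rw [const]
        rintro _ ⟨_, ⟨s, hs, rfl⟩, rfl⟩ _ ⟨_, ⟨s', hs', rfl⟩, rfl⟩
        simp
      · rw [const]
        rintro _ ⟨_, ⟨s, hs, rfl⟩, rfl⟩ _ ⟨_, ⟨s', hs', rfl⟩, rfl⟩
        simp
      · rw [sat_or_left fun _ => sat_varNe]
        obtain h | h := hφ
        · exact h₁ M _ _ _ l₁ (cov c) h |>.mono Set.sdiff_subset
        -- The bit selects the other disjunct, so `φ` is only required of the empty team.
        · refine φ.sat_empty.mono ?_
          rintro _ ⟨⟨_, ⟨s, hs, rfl⟩, rfl⟩, hne⟩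
          exact hne (by simpa using h)
      · rw [sat_or_left fun _ => sat_varEq]
        obtain h | h := hψ
        · exact h₂ M _ _ _ l₂ (cov c) h |>.mono Set.sdiff_subset
        · refine ψ.sat_empty.mono ?_
          rintro _ ⟨⟨_, ⟨s, hs, rfl⟩, rfl⟩, hne⟩
          exact hne (by simpa using h)
    rintro (h | h)
    · exact key a (Or.inl h) (Or.inr rfl)
    · exact key b (Or.inr hab) (Or.inl h)

/-! ### Guarded translation of transition terms -/

/-- A condition on assignments that depends only on the variables in `[N, K)` and is expressed,
together with its negation, by flat formulas of Dependence Logic. -/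
structure Guard (L : FirstOrder.Language.{u, v}) (N K : ℕ) where
  pos : DLFormula L
  neg : DLFormula L
  cond : ∀ M : Type w, Team M
  sat_pos : ∀ (M : Type w) [L.Structure M] (X : Team M), pos.Sat X ↔ X ⊆ cond M
  sat_neg : ∀ (M : Type w) [L.Structure M] (X : Team M), neg.Sat X ↔ X ⊆ (cond M)ᶜ
  agree : ∀ (M : Type w) (s s' : ℕ → M), Set.EqOn s s' (Set.Ico N K) → s ∈ cond M → s' ∈ cond M

namespace Guard

variable {N K : ℕ}

lemma mem_iff (g : Guard.{u, v, w} L N K) {s s' : ℕ → M} (h : Set.EqOn s s' (Set.Ico N K)) :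
    s ∈ g.cond M ↔ s' ∈ g.cond M :=
  ⟨g.agree M s s' h, g.agree M s' s h.symm⟩

lemma mem_update (g : Guard.{u, v, w} L N K) {s : ℕ → M} {x : ℕ} (hx : x ∉ Set.Ico N K) {m : M} :
    Function.update s x m ∈ g.cond M ↔ s ∈ g.cond M := by
  refine g.mem_iff fun i hi => Function.update_of_ne ?_ _ _
  rintro rfl
  exact hx hi

/-- The condition that always holds. -/
def trivial (L : FirstOrder.Language.{u, v}) (N : ℕ) : Guard.{u, v, w} L N N where
  pos := .varEq L 0 0
  neg := .varNe L 0 0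
  cond _ := Set.univ
  sat_pos _ _ X := ⟨fun _ => Set.subset_univ X, fun _ _ _ => rfl⟩
  sat_neg _ _ _ := ⟨fun h s hs => absurd rfl (h s hs), fun h s hs => absurd (Set.mem_univ s) (h hs)⟩
  agree _ _ _ _ _ := Set.mem_univ _

/-- Enlarge the set of variables that a condition may depend on. -/
def widen (g : Guard.{u, v, w} L N K) {N' K' : ℕ} (hN : N' ≤ N) (hK : K ≤ K') :
    Guard.{u, v, w} L N' K' where
  __ := g
  agree M s s' h := g.agree M s s' (h.mono (Set.Ico_subset_Ico hN hK))

/-- The conjunction of a condition with the equality of two fresh variables. -/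
def andEq (g : Guard.{u, v, w} L N K) (h : N ≤ K) : Guard.{u, v, w} L N (K + 2) where
  pos := .and g.pos (.varEq L K (K + 1))
  neg := .or g.neg (.varNe L K (K + 1))
  cond M := g.cond M ∩ {s | s K = s (K + 1)}
  sat_pos M _ X := by
    rw [Set.subset_inter_iff, ← g.sat_pos, ← DLFormula.sat_varEq (L := L)]
    rfl
  sat_neg M _ X := by
    rw [DLFormula.sat_or_left (g.sat_neg M), DLFormula.sat_varNe, Set.sdiff_subset_iff,
      Set.compl_inter]
  agree M s s' e hs := by
    refine ⟨g.agree M s s' (e.mono (Set.Ico_subset_Ico le_rfl (by omega))) hs.1, ?_⟩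
    show s' K = s' (K + 1)
    rw [← e ⟨h, by omega⟩, ← e (show K + 1 ∈ Set.Ico N (K + 2) from ⟨by omega, by omega⟩)]
    exact hs.2

/-- The conjunction of a condition with the inequality of two fresh variables. -/
def andNe (g : Guard.{u, v, w} L N K) (h : N ≤ K) : Guard.{u, v, w} L N (K + 2) where
  pos := .and g.pos (.varNe L K (K + 1))
  neg := .or g.neg (.varEq L K (K + 1))
  cond M := g.cond M \ {s | s K = s (K + 1)}
  sat_pos M _ X := by
    rw [Set.sdiff_eq, Set.subset_inter_iff, ← g.sat_pos, ← DLFormula.sat_varNe (L := L)]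
    rfl
  sat_neg M _ X := by
    rw [DLFormula.sat_or_left (g.sat_neg M), DLFormula.sat_varEq, Set.sdiff_subset_iff]
    refine forall₂_congr fun s _ => ?_
    simp only [Set.mem_compl_iff, Set.mem_sdiff, Set.mem_union]
    tauto
  agree M s s' e hs := by
    refine ⟨g.agree M s s' (e.mono (Set.Ico_subset_Ico le_rfl (by omega))) hs.1, ?_⟩
    show s' K ≠ s' (K + 1)
    rw [← e ⟨h, by omega⟩, ← e (show K + 1 ∈ Set.Ico N (K + 2) from ⟨by omega, by omega⟩)]
    exact hs.2

end Guard

-- Translatable transition terms and their closure properties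

/-- The transition term `τ` does not touch the variables from `N` on, and its weakest
preconditions, restricted to the part of a team that satisfies a given guard, are definable in
Dependence Logic. -/
structure Translatable (τ : TDLTerm L) (N : ℕ) : Prop where
  mono : ∀ (M : Type w) [L.Structure M] [Nontrivial M] (X Y Y' : Team M),
    Y ⊆ Y' → τ.Allows X Y → τ.Allows X Y'
  saturate : ∀ (M : Type w) [L.Structure M] [Nontrivial M] (S : Set ℕ) (X X' Y : Team M),
    Set.Iio N ⊆ S → X'.Covered S X → τ.Allows X Y → τ.Allows X' (Y.saturate S)
  restrict : ∀ (M : Type w) [L.Structure M] [Nontrivial M] (C X Y : Team M),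
    (∀ s s', Set.EqOn s s' (Set.Ici N) → s ∈ C → s' ∈ C) → X ⊆ C →
      τ.Allows X Y → τ.Allows X (Y ∩ C)
  definable : ∀ (K : ℕ) (g : Guard.{u, v, w} L N K) (θ : DLFormula L),
    ∃ G : DLFormula L, ∀ (M : Type w) [L.Structure M] [Nontrivial M] (X : Team M),
      G.Sat X ↔ ∃ Y : Team M, τ.Allows (X ∩ g.cond M) Y ∧ θ.Sat (Y ∪ X \ g.cond M)

namespace Translatable

lemma weaken {τ : TDLTerm L} {N N' : ℕ} (h : Translatable.{u, v, w} τ N) (hN : N ≤ N') :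
    Translatable.{u, v, w} τ N' where
  mono := h.mono
  saturate M _ _ S X X' Y hS := h.saturate M S X X' Y ((Set.Iio_subset_Iio hN).trans hS)
  restrict M _ _ C X Y hC := h.restrict M C X Y fun s s' e =>
    hC s s' (e.mono (Set.Ici_subset_Ici.2 hN))
  definable K g := h.definable K (g.widen hN le_rfl)

/-- For `S = Set.univ` covering is inclusion and saturation adds nothing, so `saturate` specializes
to this. -/
lemma anti {τ : TDLTerm L} {N : ℕ} (h : Translatable.{u, v, w} τ N) [L.Structure M] [Nontrivial M]
    {X X' Y : Team M} (hX : X' ⊆ X) (hY : τ.Allows X Y) : τ.Allows X' Y := by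
  refine h.mono M _ _ _ ?_
    (h.saturate M Set.univ X X' Y (Set.subset_univ _) (Team.covered_of_subset hX) hY)
  rintro s ⟨s', hs', e⟩
  rwa [← (Set.eqOn_univ _ _).1 e]

lemma restrict_guard {τ : TDLTerm L} {N K : ℕ} (h : Translatable.{u, v, w} τ N) [L.Structure M]
    [Nontrivial M] (g : Guard.{u, v, w} L N K) {X Y : Team M} (hX : X ⊆ g.cond M)
    (hY : τ.Allows X Y) : τ.Allows X (Y ∩ g.cond M) :=
  h.restrict M _ _ _ (fun s s' e => g.agree M s s' (e.mono Set.Ico_subset_Ici_self)) hX hY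

lemma update_mem {N x : ℕ} (hx : x < N) {C : Team M}
    (hC : ∀ s s', Set.EqOn s s' (Set.Ici N) → s ∈ C → s' ∈ C) {s : ℕ → M} (hs : s ∈ C) (m : M) :
    Function.update s x m ∈ C := by
  refine hC s _ (fun i hi => (Function.update_of_ne ?_ _ _).symm) hs
  have : N ≤ i := hi
  omega

lemma agree_update {K : ℕ} (s : ℕ → M) (m : M) :
    Set.EqOn s (Function.update s K m) (Set.Iio K) :=
  fun _ hi => (Function.update_of_ne (ne_of_lt hi) _ _).symm

theorem ex (x : ℕ) : Translatable.{u, v, w} (TDLTerm.ex x : TDLTerm L) (x + 1) where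
  mono := by
    rintro M _ _ X Y Y' hY ⟨F, hF⟩
    exact ⟨F, hF.trans hY⟩
  saturate := by
    rintro M _ _ S X X' Y hS hX ⟨F, hF⟩
    obtain ⟨F', hF'⟩ := hX.supplement x F
    refine ⟨F', fun s hs => ?_⟩
    obtain ⟨s', h, e⟩ := hF' s hs
    exact ⟨s', hF h, e⟩
  restrict := by
    rintro M _ _ C X Y hC hX ⟨F, hF⟩
    refine ⟨F, fun s hs => ⟨hF hs, ?_⟩⟩
    obtain ⟨s, hs, rfl⟩ := hs
    exact update_mem (Nat.lt_succ_self x) hC (hX hs) _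
  definable := by
    intro K g θ
    obtain ⟨N, hN⟩ := θ.exists_bound
    set p := max N (max K (x + 1)) with hp
    have l : Set.Iio N ⊆ Set.Iio p := Set.Iio_subset_Iio (le_max_left _ _)
    have hxp : x < p := by omega
    have hx : x ∉ Set.Ico (x + 1) K := fun h => absurd h.1 (by omega)
    have hpK : p ∉ Set.Ico (x + 1) K := fun h => absurd h.2 (by omega)
    -- The old value of `x` is kept in `p`; rows outside the guard must choose it again and so do
    -- not change.
    refine ⟨.ex p (.and (.varEq L p x) (.ex x (.and (.or g.pos (.varEq L p x)) θ))), ?_⟩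
    intro M _ _ X
    rw [DLFormula.sat_copy hxp.ne]
    constructor
    · rintro ⟨F, h₁, h₂⟩
      rw [DLFormula.sat_or_left (g.sat_pos M), DLFormula.sat_varEq] at h₁
      refine ⟨_, ⟨fun s => F (Function.update s p (s x)), subset_rfl⟩, ?_⟩
      refine hN M _ _ _ l ?_ h₂
      rintro _ (⟨s, ⟨hs, hc⟩, rfl⟩ | ⟨hs, hc⟩)
      · exact ⟨_, ⟨_, ⟨s, hs, rfl⟩, rfl⟩, eqOn_update (agree_update s _).symm _ _⟩
      · rename_i s
        refine ⟨_, ⟨_, ⟨s, hs, rfl⟩, rfl⟩, ?_⟩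
        have := h₁ ⟨⟨_, ⟨s, hs, rfl⟩, rfl⟩, by rwa [g.mem_update hx, g.mem_update hpK]⟩
        simp only [Set.mem_ofPred_eq, Function.update_self, Function.update_of_ne hxp.ne'] at this
        rw [← this, Function.update_comm hxp.ne', Function.update_eq_self]
        exact (agree_update s _).symm
    · rintro ⟨Y, ⟨F, hF⟩, hθ⟩
      classical
      have pre : ∀ s' ∈ X.supplement p fun s => s x, ∃ s ∈ X, s' = Function.update s p (s x) :=
        fun _ h => h
      -- The given `F` may depend on the value at `p`, which the copy has overwritten, so each row
      -- is traced back to some original row `q s'`.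
      choose! q hqX hq using pre
      refine ⟨fun s' => if q s' ∈ g.cond M then F (q s') else q s' x, ?_, ?_⟩
      · rw [DLFormula.sat_or_left (g.sat_pos M), DLFormula.sat_varEq]
        rintro _ ⟨⟨s', hs', rfl⟩, hc⟩
        have hc' : q s' ∉ g.cond M := fun h => hc (by
          rw [g.mem_update hx, hq s' hs', g.mem_update hpK]
          exact h)
        have hsp : s' p = q s' x := (congrFun (hq s' hs') p).trans (Function.update_self _ _ _)
        simp only [Set.mem_ofPred_eq, Function.update_self, Function.update_of_ne hxp.ne',
          if_neg hc', hsp]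
      · refine hN M _ _ _ l ?_ hθ
        rintro _ ⟨s', hs', rfl⟩
        have e : Set.EqOn (q s') s' (Set.Iio p) :=
          (agree_update _ _).trans fun i _ => (congrFun (hq s' hs') i).symm
        by_cases hc : q s' ∈ g.cond M
        · simp only [if_pos hc]
          exact ⟨_, Or.inl (hF ⟨_, ⟨hqX s' hs', hc⟩, rfl⟩), eqOn_update e _ _⟩
        · simp only [if_neg hc]
          rw [e hxp, Function.update_eq_self]
          exact ⟨q s', Or.inr ⟨hqX s' hs', hc⟩, e⟩

theorem all (x : ℕ) : Translatable.{u, v, w} (TDLTerm.all x : TDLTerm L) (x + 1) where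
  mono M _ _ X Y Y' hY h := h.trans hY
  saturate := by
    intro M _ _ S X X' Y hS hX h s hs
    obtain ⟨s', h', e⟩ := hX.duplicate x s hs
    exact ⟨s', h h', e⟩
  restrict := by
    intro M _ _ C X Y hC hX h s hs
    refine ⟨h hs, ?_⟩
    obtain ⟨s, hs, m, rfl⟩ := hs
    exact update_mem (Nat.lt_succ_self x) hC (hX hs) _
  definable := by
    intro K g θ
    obtain ⟨N, hN⟩ := θ.exists_bound
    set p := max N (max K (x + 1)) with hp
    have l : Set.Iio N ⊆ Set.Iio p := Set.Iio_subset_Iio (le_max_left _ _)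
    have hxp : x < p := by omega
    have hx : x ∉ Set.Ico (x + 1) K := fun h => absurd h.1 (by omega)
    have hpK : p ∉ Set.Ico (x + 1) K := fun h => absurd h.2 (by omega)
    -- The quantifier also alters rows outside the guard; the flat disjunct discards exactly those
    -- whose `x` differs from the saved value.
    refine ⟨.ex p (.and (.varEq L p x) (.all x (.or (.and g.neg (.varNe L p x)) θ))), ?_⟩
    intro M _ _ X
    have flat : ∀ Z : Team M, (DLFormula.and g.neg (.varNe L p x)).Sat Z ↔
        Z ⊆ (g.cond M)ᶜ ∩ {s | s p = s x}ᶜ := by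
      intro Z
      rw [Set.subset_inter_iff, ← g.sat_neg, ← DLFormula.sat_varNe (L := L)]
      rfl
    rw [DLFormula.sat_copy hxp.ne]
    refine (DLFormula.sat_or_left flat _).trans ?_
    constructor
    · intro h
      refine ⟨_, subset_rfl, hN M _ _ _ l ?_ h⟩
      rintro _ (⟨s, ⟨hs, hc⟩, m, rfl⟩ | ⟨hs, hc⟩)
      · refine ⟨_, ⟨⟨_, ⟨s, hs, rfl⟩, m, rfl⟩, fun hn => hn.1 ?_⟩,
          eqOn_update (agree_update s _).symm _ _⟩
        rwa [g.mem_update hx, g.mem_update hpK]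
      · rename_i s
        refine ⟨_, ⟨⟨_, ⟨s, hs, rfl⟩, s x, rfl⟩, fun hn => hn.2 ?_⟩, ?_⟩
        · simp [hxp.ne']
        · rw [Function.update_comm hxp.ne', Function.update_eq_self]
          exact (agree_update s _).symm
    · rintro ⟨Y, hY, hθ⟩
      refine hN M _ _ _ l ?_ hθ
      rintro _ ⟨⟨_, ⟨s, hs, rfl⟩, m, rfl⟩, hn⟩
      by_cases hc : s ∈ g.cond M
      · exact ⟨_, Or.inl (hY ⟨s, ⟨hs, hc⟩, m, rfl⟩), eqOn_update (agree_update s _) _ _⟩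
      · refine ⟨s, Or.inr ⟨hs, hc⟩, ?_⟩
        have : m = s x := by
          by_contra hm
          refine hn ⟨?_, ?_⟩
          · rwa [Set.mem_compl_iff, g.mem_update hx, g.mem_update hpK]
          · simpa [hxp.ne'] using Ne.symm hm
        rw [this, Function.update_comm hxp.ne', Function.update_eq_self]
        exact agree_update s _

theorem test {φ : TDLFormula L} {T : DLFormula L}
    (hT : ∀ (M : Type w) [L.Structure M] [Nontrivial M] (X : Team M), φ.Sat X ↔ T.Sat X) :
    ∃ N, Translatable.{u, v, w} (TDLTerm.test φ) N := by
  obtain ⟨N, hN⟩ := T.exists_bound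
  refine ⟨N, ?_, ?_, ?_, ?_⟩
  · rintro M _ _ X Y Y' hY ⟨h, hX⟩
    exact ⟨h, hX.trans hY⟩
  · rintro M _ _ S X X' Y hS hX ⟨h, hXY⟩
    refine ⟨(hT M X').2 (hN M S X X' hS hX ((hT M X).1 h)), fun s hs => ?_⟩
    obtain ⟨s', h', e⟩ := hX s hs
    exact ⟨s', hXY h', e⟩
  · rintro M _ _ C X Y hC hX ⟨h, hXY⟩
    exact ⟨h, Set.subset_inter hXY hX⟩
  · intro K g θ
    -- By downward closure of `θ` the smallest target `Y = X ∩ g.cond M` is optimal, and then `Y ∪ X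
    -- \ g.cond M` is `X` itself.
    refine ⟨.and θ (.or g.neg T), fun M _ _ X => ?_⟩
    have h₁ : (DLFormula.and θ (.or g.neg T)).Sat X ↔ θ.Sat X ∧ T.Sat (X ∩ g.cond M) := by
      rw [← Set.sdiff_compl, ← DLFormula.sat_or_left (g.sat_neg M)]
      rfl
    rw [h₁]
    constructor
    · rintro ⟨hθ, h⟩
      exact ⟨_, ⟨(hT M _).2 h, subset_rfl⟩, by rwa [Set.inter_union_sdiff]⟩
    · rintro ⟨Y, ⟨h, hY⟩, hθ⟩
      refine ⟨hθ.mono ?_, (hT M _).1 h⟩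
      conv_lhs => rw [← Set.inter_union_sdiff X (g.cond M)]
      exact Set.union_subset_union_left _ hY

/-- Preconditions compose under the same guard: the intermediate team can be cut down to the guard,
so the second term acts on the output of the first and never on the rows kept aside. -/
theorem seq {τ₁ τ₂ : TDLTerm L} {N : ℕ} (h₁ : Translatable.{u, v, w} τ₁ N)
    (h₂ : Translatable.{u, v, w} τ₂ N) : Translatable.{u, v, w} (TDLTerm.seq τ₁ τ₂) N where
  mono := by
    rintro M _ _ X Y Y' hY ⟨Z, hZ, h⟩
    exact ⟨Z, hZ, h₂.mono M Z Y Y' hY h⟩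
  saturate := by
    rintro M _ _ S X X' Y hS hX ⟨Z, hZ, h⟩
    exact ⟨Z.saturate S, h₁.saturate M S X X' Z hS hX hZ,
      h₂.saturate M S Z _ Y hS (Team.covered_saturate S Z) h⟩
  restrict := by
    rintro M _ _ C X Y hC hX ⟨Z, hZ, h⟩
    exact ⟨Z ∩ C, h₁.restrict M C X Z hC hX hZ,
      h₂.restrict M C _ Y hC Set.inter_subset_right (h₂.anti Set.inter_subset_left h)⟩
  definable := by
    intro K g θ
    obtain ⟨G₂, hG₂⟩ := h₂.definable K g θ
    obtain ⟨G₁, hG₁⟩ := h₁.definable K g G₂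
    refine ⟨G₁, fun M _ _ X => ?_⟩
    rw [hG₁]
    constructor
    · rintro ⟨Z, hZ, hG⟩
      obtain ⟨Y, hY, hθ⟩ := (hG₂ M _).1 hG
      refine ⟨Y, ⟨Z ∩ g.cond M, h₁.restrict_guard g Set.inter_subset_right hZ,
        h₂.anti ?_ hY⟩, hθ.mono ?_⟩
      · exact Set.inter_subset_inter_left _ Set.subset_union_left
      · exact Set.union_subset_union_right _ fun s hs => ⟨Or.inr hs, hs.2⟩
    · rintro ⟨Y, ⟨Z, hZ, hY⟩, hθ⟩
      refine ⟨Z ∩ g.cond M, h₁.restrict_guard g Set.inter_subset_right hZ,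
        (hG₂ M _).2 ⟨Y, h₂.anti ?_ hY, hθ.mono ?_⟩⟩
      · rintro s ⟨hs | hs, hc⟩
        · exact hs.1
        · exact absurd hc hs.2
      · rintro s (hs | ⟨hs | hs, hc⟩)
        · exact Or.inl hs
        · exact absurd hs.2 hc
        · exact Or.inr hs

-- Two branches with a common target

/-- Running two transition terms on the two parts of a team given by a pair of fresh variables. -/
lemma exists_branch {τ₁ τ₂ : TDLTerm L} {N K : ℕ} (h₁ : Translatable.{u, v, w} τ₁ N)
    (h₂ : Translatable.{u, v, w} τ₂ N) (hK : N ≤ K) (g : Guard.{u, v, w} L N K)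
    (θ : DLFormula L) :
    ∃ G : DLFormula L, ∀ (M : Type w) [L.Structure M] [Nontrivial M] (X : Team M),
      G.Sat X ↔ ∃ Y : Team M, τ₁.Allows (X ∩ (g.cond M ∩ {s | s K = s (K + 1)})) Y ∧
        τ₂.Allows (X ∩ (g.cond M \ {s | s K = s (K + 1)})) Y ∧ θ.Sat (Y ∪ X \ g.cond M) := by
  obtain ⟨G₂, hG₂⟩ := h₂.definable _ (g.andNe hK) θ
  obtain ⟨G₁, hG₁⟩ := h₁.definable _ (g.andEq hK) G₂
  refine ⟨G₁, fun M _ _ X => ?_⟩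
  set D : Team M := {s | s K = s (K + 1)}
  have e₁ : (g.andEq hK).cond M = g.cond M ∩ D := rfl
  have e₂ : (g.andNe hK).cond M = g.cond M \ D := rfl
  rw [hG₁, e₁]
  constructor
  · rintro ⟨Y₁, hY₁, hG⟩
    obtain ⟨Y₂, hY₂, hθ⟩ := (hG₂ M _).1 hG
    rw [e₂] at hY₂ hθ
    -- Trimmed to the first guard, the output of `τ₁` lies outside the second guard. The run of `τ₂`
    -- therefore keeps it, and it is still present when `θ` is evaluated.
    refine ⟨(Y₁ ∩ (g.cond M ∩ D)) ∪ Y₂, h₁.mono M _ _ _ Set.subset_union_left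
      (h₁.restrict_guard (g.andEq hK) Set.inter_subset_right hY₁),
      h₂.mono M _ _ _ Set.subset_union_right (h₂.anti ?_ hY₂), hθ.mono ?_⟩
    · rintro s ⟨hs, hc⟩
      exact ⟨Or.inr ⟨hs, fun h => hc.2 h.2⟩, hc⟩
    · rintro s ((hs | hs) | hs)
      · exact Or.inr ⟨Or.inl hs.1, fun h => h.2 hs.2.2⟩
      · exact Or.inl hs
      · exact Or.inr ⟨Or.inr ⟨hs.1, fun h => hs.2 h.1⟩, fun h => hs.2 h.1⟩
  · rintro ⟨Y, hY₁, hY₂, hθ⟩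
    refine ⟨Y ∩ (g.cond M ∩ D), h₁.restrict_guard (g.andEq hK) Set.inter_subset_right hY₁,
      (hG₂ M _).2 ⟨Y, h₂.anti ?_ hY₂, hθ.mono ?_⟩⟩
    · rintro s ⟨hs | hs, hc⟩
      · exact absurd hs.2.2 hc.2
      · exact ⟨hs.1, hc⟩
    · rintro s (hs | ⟨hs | ⟨hs, h⟩, hc⟩)
      · exact Or.inl hs
      · exact Or.inl hs.1
      · refine Or.inr ⟨hs, fun h' => ?_⟩
        by_cases hD : s ∈ D
        · exact h ⟨h', hD⟩
        · exact hc ⟨h', hD⟩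

lemma agree_update₂ {p : ℕ} (s : ℕ → M) (a b : M) :
    Set.EqOn s (Function.update (Function.update s p a) (p + 1) b) (Set.Iio p) :=
  (agree_update s a).trans ((agree_update _ b).mono (Set.Iio_subset_Iio (Nat.le_succ p)))

theorem tensor {τ₁ τ₂ : TDLTerm L} {N : ℕ} (h₁ : Translatable.{u, v, w} τ₁ N)
    (h₂ : Translatable.{u, v, w} τ₂ N) : Translatable.{u, v, w} (TDLTerm.tensor τ₁ τ₂) N where
  mono := by
    rintro M _ _ X Y Y' hY ⟨X₁, X₂, hX, hY₁, hY₂⟩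
    exact ⟨X₁, X₂, hX, h₁.mono M _ _ _ hY hY₁, h₂.mono M _ _ _ hY hY₂⟩
  saturate := by
    rintro M _ _ S X X' Y hS hX ⟨X₁, X₂, rfl, hY₁, hY₂⟩
    obtain ⟨X₁', X₂', rfl, c₁, c₂⟩ := hX.exists_union
    exact ⟨X₁', X₂', rfl, h₁.saturate M S _ _ _ hS c₁ hY₁, h₂.saturate M S _ _ _ hS c₂ hY₂⟩
  restrict := by
    rintro M _ _ C X Y hC hX ⟨X₁, X₂, rfl, hY₁, hY₂⟩
    exact ⟨X₁, X₂, rfl, h₁.restrict M C _ _ hC (Set.subset_union_left.trans hX) hY₁,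
      h₂.restrict M C _ _ hC (Set.subset_union_right.trans hX) hY₂⟩
  definable := by
    intro K g θ
    obtain ⟨B, hB⟩ := θ.exists_bound
    set p := max N (max B K) with hp
    have lB : Set.Iio B ⊆ Set.Iio p := Set.Iio_subset_Iio (by omega)
    have lN : Set.Iio N ⊆ Set.Iio p := Set.Iio_subset_Iio (by omega)
    have lK : Set.Ico N K ⊆ Set.Iio p := fun i hi => lt_of_lt_of_le hi.2 (by omega)
    obtain ⟨G, hG⟩ := exists_branch h₁ h₂ (le_max_left N (max B K)) (g.widen le_rfl
      (show K ≤ p by omega)) θ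
    refine ⟨.ex p (.ex (p + 1) G), fun M _ _ X => ?_⟩
    have e : (g.widen le_rfl (show K ≤ p by omega)).cond M = g.cond M := rfl
    constructor
    · rintro ⟨F, F', h⟩
      rw [hG, e, ← hp] at h
      obtain ⟨Y, hY₁, hY₂, hθ⟩ := h
      let f : (ℕ → M) → ℕ → M := fun s => Function.update (Function.update s p (F s)) (p + 1)
        (F' (Function.update s p (F s)))
      have hf : ∀ s, Set.EqOn (f s) s (Set.Iio p) := fun s => (agree_update₂ s _ _).symm
      have hX : ∀ s ∈ X, f s ∈ (X.supplement p F).supplement (p + 1) F' :=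
        fun s hs => ⟨_, ⟨s, hs, rfl⟩, rfl⟩
      have hg : ∀ s, f s ∈ g.cond M ↔ s ∈ g.cond M := fun s => g.mem_iff ((hf s).mono lK)
      -- The tags chosen for a row decide its half. Saturating `Y` below `p` forgets the tags, since
      -- neither the terms nor `θ` can see them.
      refine ⟨Y.saturate (Set.Iio p), ⟨X ∩ g.cond M ∩ {s | f s p = f s (p + 1)},
        (X ∩ g.cond M) \ {s | f s p = f s (p + 1)}, (Set.inter_union_sdiff _ _).symm, ?_, ?_⟩, ?_⟩
      · refine h₁.saturate M _ _ _ _ lN ?_ hY₁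
        rintro s ⟨⟨hs, hc⟩, hd⟩
        exact ⟨f s, ⟨hX s hs, (hg s).2 hc, hd⟩, hf s⟩
      · refine h₂.saturate M _ _ _ _ lN ?_ hY₂
        rintro s ⟨⟨hs, hc⟩, hd⟩
        exact ⟨f s, ⟨hX s hs, (hg s).2 hc, hd⟩, hf s⟩
      · refine hB M _ _ _ lB ((Team.covered_saturate _ Y).union ?_) hθ
        rintro s ⟨hs, hc⟩
        exact ⟨f s, ⟨hX s hs, fun h => hc ((hg s).1 h)⟩, hf s⟩
    · rintro ⟨Y, ⟨X₁, X₂, hX, hY₁, hY₂⟩, hθ⟩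
      obtain ⟨a, b, hab⟩ := exists_pair_ne M
      classical
      have pre : ∀ s' ∈ X.supplement p fun _ => a, ∃ s ∈ X, s' = Function.update s p a :=
        fun _ h => h
      choose! q hqX hq using pre
      have key : ∀ s' ∈ (X.supplement p fun _ => a).supplement (p + 1)
          fun s => if q s ∈ X₁ then a else b,
          ∃ s ∈ X, Set.EqOn s s' (Set.Iio p) ∧ (s' p = s' (p + 1) ↔ s ∈ X₁) := by
        rintro _ ⟨s', hs', rfl⟩
        have e : Set.EqOn (q s') s' (Set.Iio p) :=
          (agree_update _ _).trans fun i _ => (congrFun (hq s' hs') i).symm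
        refine ⟨q s', hqX s' hs', e.trans ((agree_update _ _).mono
          (Set.Iio_subset_Iio (Nat.le_succ p))), ?_⟩
        · have ha : s' p = a := (congrFun (hq s' hs') p).trans (Function.update_self _ _ _)
          rw [Function.update_self, Function.update_of_ne (Nat.lt_succ_self p).ne, ha]
          by_cases h : q s' ∈ X₁ <;> simp [h, hab]
      -- Rows in both `X₁` and `X₂` are sent only to the first branch. Membership is tested on the
      -- original row `q s` because `X₁` may depend on the overwritten variable `p`.
      refine ⟨fun _ => a, fun s => if q s ∈ X₁ then a else b, (hG M _).2
        ⟨Y.saturate (Set.Iio p), h₁.saturate M _ _ _ _ lN ?_ hY₁,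
          h₂.saturate M _ _ _ _ lN ?_ hY₂, ?_⟩⟩
      · rintro s' ⟨hs', -, hd⟩
        obtain ⟨s, -, hss, h⟩ := key s' hs'
        exact ⟨s, h.1 hd, hss⟩
      · rintro s' ⟨hs', hc, hd⟩
        obtain ⟨s, hs, hss, h⟩ := key s' hs'
        have : s ∈ X₁ ∪ X₂ := hX ▸ ⟨hs, (g.mem_iff (hss.mono lK)).2 hc⟩
        exact ⟨s, this.resolve_left fun h' => hd (h.2 h'), hss⟩
      · refine hB M _ _ _ lB ((Team.covered_saturate _ Y).union ?_) hθ
        rintro s' ⟨hs', hc⟩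
        obtain ⟨s, hs, hss, -⟩ := key s' hs'
        exact ⟨s, ⟨hs, fun h => hc ((g.mem_iff (hss.mono lK)).1 h)⟩, hss⟩

theorem inter {τ₁ τ₂ : TDLTerm L} {N : ℕ} (h₁ : Translatable.{u, v, w} τ₁ N)
    (h₂ : Translatable.{u, v, w} τ₂ N) : Translatable.{u, v, w} (TDLTerm.inter τ₁ τ₂) N where
  mono := by
    rintro M _ _ X Y Y' hY ⟨hY₁, hY₂⟩
    exact ⟨h₁.mono M _ _ _ hY hY₁, h₂.mono M _ _ _ hY hY₂⟩
  saturate := by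
    rintro M _ _ S X X' Y hS hX ⟨hY₁, hY₂⟩
    exact ⟨h₁.saturate M S _ _ _ hS hX hY₁, h₂.saturate M S _ _ _ hS hX hY₂⟩
  restrict := by
    rintro M _ _ C X Y hC hX ⟨hY₁, hY₂⟩
    exact ⟨h₁.restrict M C _ _ hC hX hY₁, h₂.restrict M C _ _ hC hX hY₂⟩
  definable := by
    intro K g θ
    obtain ⟨B, hB⟩ := θ.exists_bound
    set p := max N (max B K) with hp
    have lB : Set.Iio B ⊆ Set.Iio p := Set.Iio_subset_Iio (by omega)
    have lN : Set.Iio N ⊆ Set.Iio p := Set.Iio_subset_Iio (by omega)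
    have lK : Set.Ico N K ⊆ Set.Iio p := fun i hi => lt_of_lt_of_le hi.2 (by omega)
    obtain ⟨G, hG⟩ := exists_branch h₁ h₂ (le_max_left N (max B K)) (g.widen le_rfl
      (show K ≤ p by omega)) θ
    refine ⟨.all p (.all (p + 1) G), fun M _ _ X => ?_⟩
    have e : (g.widen le_rfl (show K ≤ p by omega)).cond M = g.cond M := rfl
    let f : M → M → (ℕ → M) → ℕ → M := fun a b s =>
      Function.update (Function.update s p a) (p + 1) b
    have hf : ∀ a b s, Set.EqOn (f a b s) s (Set.Iio p) :=
      fun a b s => (agree_update₂ s a b).symm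
    have hX : ∀ a b, ∀ s ∈ X, f a b s ∈ (X.duplicate p).duplicate (p + 1) :=
      fun a b s hs => ⟨_, ⟨s, hs, a, rfl⟩, b, rfl⟩
    have hg : ∀ a b s, f a b s ∈ g.cond M ↔ s ∈ g.cond M :=
      fun a b s => g.mem_iff ((hf a b s).mono lK)
    have hd : ∀ a b s, f a b s p = f a b s (p + 1) ↔ a = b := fun a b s => by simp [f]
    simp only [DLFormula.Sat]
    rw [hG, e, ← hp]
    constructor
    · rintro ⟨Y, hY₁, hY₂, hθ⟩
      -- Each row has a copy tagged `(a, a)` and a copy tagged `(a, b)`, so the whole guarded team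
      -- passes through both branches; without `a ≠ b` the second would be empty.
      obtain ⟨a, b, hab⟩ := exists_pair_ne M
      refine ⟨Y.saturate (Set.Iio p), ⟨?_, ?_⟩, ?_⟩
      · refine h₁.saturate M _ _ _ _ lN ?_ hY₁
        rintro s ⟨hs, hc⟩
        exact ⟨f a a s, ⟨hX a a s hs, (hg a a s).2 hc, (hd a a s).2 rfl⟩, hf a a s⟩
      · refine h₂.saturate M _ _ _ _ lN ?_ hY₂
        rintro s ⟨hs, hc⟩
        exact ⟨f a b s, ⟨hX a b s hs, (hg a b s).2 hc, fun h => hab ((hd a b s).1 h)⟩, hf a b s⟩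
      · refine hB M _ _ _ lB ((Team.covered_saturate _ Y).union ?_) hθ
        rintro s ⟨hs, hc⟩
        exact ⟨f a a s, ⟨hX a a s hs, fun h => hc ((hg a a s).1 h)⟩, hf a a s⟩
    · rintro ⟨Y, ⟨hY₁, hY₂⟩, hθ⟩
      have cov : ((X.duplicate p).duplicate (p + 1) ∩ g.cond M).Covered (Set.Iio p)
          (X ∩ g.cond M) := by
        rintro _ ⟨⟨_, ⟨s, hs, a, rfl⟩, b, rfl⟩, hc⟩
        exact ⟨s, ⟨hs, (hg a b s).1 hc⟩, (hf a b s).symm⟩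
      refine ⟨Y.saturate (Set.Iio p), h₁.anti ?_ (h₁.saturate M _ _ _ _ lN cov hY₁),
        h₂.anti ?_ (h₂.saturate M _ _ _ _ lN cov hY₂), ?_⟩
      · exact fun s hs => ⟨hs.1, hs.2.1⟩
      · exact fun s hs => ⟨hs.1, hs.2.1⟩
      · refine hB M _ _ _ lB ((Team.covered_saturate _ Y).union ?_) hθ
        rintro _ ⟨⟨_, ⟨s, hs, a, rfl⟩, b, rfl⟩, hc⟩
        exact ⟨s, ⟨hs, fun h => hc ((hg a b s).2 h)⟩, (hf a b s).symm⟩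

/-- With the trivial guard no row is set aside, and the relativized precondition becomes the
ordinary one. -/
theorem exists_precondition {τ : TDLTerm L} {N : ℕ} (h : Translatable.{u, v, w} τ N)
    (θ : DLFormula L) :
    ∃ G : DLFormula L, ∀ (M : Type w) [L.Structure M] [Nontrivial M] (X : Team M),
      G.Sat X ↔ ∃ Y : Team M, τ.Allows X Y ∧ θ.Sat Y := by
  obtain ⟨G, hG⟩ := h.definable N (Guard.trivial L N) θ
  refine ⟨G, fun M _ _ X => ?_⟩
  have e : (Guard.trivial.{u, v, w} L N).cond M = Set.univ := rfl
  simpa [e] using hG M X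

end Translatable

-- Simultaneous recursion on terms and formulas

mutual

theorem TDLTerm.exists_translatable : ∀ τ : TDLTerm L, ∃ N, Translatable.{u, v, w} τ N
  | .ex x => ⟨_, .ex x⟩
  | .all x => ⟨_, .all x⟩
  | .test φ => by
    obtain ⟨T, hT⟩ := TDLFormula.exists_translation φ
    exact Translatable.test hT
  | .tensor τ₁ τ₂ => by
    obtain ⟨N₁, h₁⟩ := TDLTerm.exists_translatable τ₁
    obtain ⟨N₂, h₂⟩ := TDLTerm.exists_translatable τ₂
    exact ⟨max N₁ N₂, .tensor (h₁.weaken (le_max_left _ _)) (h₂.weaken (le_max_right _ _))⟩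
  | .inter τ₁ τ₂ => by
    obtain ⟨N₁, h₁⟩ := TDLTerm.exists_translatable τ₁
    obtain ⟨N₂, h₂⟩ := TDLTerm.exists_translatable τ₂
    exact ⟨max N₁ N₂, .inter (h₁.weaken (le_max_left _ _)) (h₂.weaken (le_max_right _ _))⟩
  | .seq τ₁ τ₂ => by
    obtain ⟨N₁, h₁⟩ := TDLTerm.exists_translatable τ₁
    obtain ⟨N₂, h₂⟩ := TDLTerm.exists_translatable τ₂
    exact ⟨max N₁ N₂, .seq (h₁.weaken (le_max_left _ _)) (h₂.weaken (le_max_right _ _))⟩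

theorem TDLFormula.exists_translation : ∀ φ : TDLFormula L, ∃ T : DLFormula L,
    ∀ (M : Type w) [L.Structure M] [Nontrivial M] (X : Team M), φ.Sat X ↔ T.Sat X
  | .atom α => ⟨.atom α, fun _ _ _ _ => Iff.rfl⟩
  | .or φ ψ => by
    obtain ⟨T₁, h₁⟩ := TDLFormula.exists_translation φ
    obtain ⟨T₂, h₂⟩ := TDLFormula.exists_translation ψ
    obtain ⟨T, hT⟩ := DLFormula.exists_classical_or T₁ T₂
    exact ⟨T, fun M _ _ X => ((h₁ M X).or (h₂ M X)).trans (hT M X).symm⟩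
  | .and φ ψ => by
    obtain ⟨T₁, h₁⟩ := TDLFormula.exists_translation φ
    obtain ⟨T₂, h₂⟩ := TDLFormula.exists_translation ψ
    exact ⟨.and T₁ T₂, fun M _ _ X => (h₁ M X).and (h₂ M X)⟩
  | .diamond τ φ => by
    obtain ⟨N, h⟩ := TDLTerm.exists_translatable τ
    obtain ⟨T₁, h₁⟩ := TDLFormula.exists_translation φ
    obtain ⟨T, hT⟩ := h.exists_precondition T₁
    exact ⟨T, fun M _ _ X =>
      (exists_congr fun Y => and_congr_right fun _ => h₁ M Y).trans (hT M X).symm⟩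

end

end TransitionDependence

theorem mainTheorem3 (L : FirstOrder.Language.{u, v}) :
    (∀ φ : TransitionDependence.TDLFormula L,
      ∃ Tφ : TransitionDependence.DLFormula L,
        ∀ (M : Type w) [L.Structure M] [Nontrivial M] (X : TransitionDependence.Team M),
          φ.Sat X ↔ Tφ.Sat X) ∧
    (∀ (τ : TransitionDependence.TDLTerm L) (θ : TransitionDependence.DLFormula L),
      ∃ Uτθ : TransitionDependence.DLFormula L,
        ∀ (M : Type w) [L.Structure M] [Nontrivial M] (X : TransitionDependence.Team M),
          Uτθ.Sat X ↔ ∃ Y : TransitionDependence.Team M, τ.Allows X Y ∧ θ.Sat Y) := by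
  refine ⟨TransitionDependence.TDLFormula.exists_translation, fun τ θ => ?_⟩
  obtain ⟨N, h⟩ := TransitionDependence.TDLTerm.exists_translatable.{u, v, w} τ
  exact h.exists_precondition θ
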